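/- For real coefficients $b=(b_{ij})_{1\le i<j\le n}$ put $$\beta(b)=\sup_{X_1,\dots,X_n\in\{-1,1\}}\ \sum_{1\le i<j\le n} b_{ij}X_iX_j .$$ A local hidden variable (LHV) model with $n$ measurements on each of two sides consists of a probability space $(\Lambda,\mu)$ and random variables $X_1,\dots,X_n,Y_1,\dots,Y_n:\Lambda\to\{-1,1\}$; write $E$ for the expectation with respect to $\mu$. For $n\ge 2$ and $K\in\mathbb R$ let $\mathcal V(n,K)$ be the statement that there exist real numbers $b_{ij}$ $(1\le i<j\le n)$, unit vectors $\mathbf x_1,\dots,\mathbf x_n\in\mathbb R^n$, a finite-dimensional complex Hilbert space $\mathcal H$, traceless Hermitian operators $A_1,\dots,A_n,B_1,\dots,B_n$ on $\mathcal H$, each with spectrum $\{1,-1\}$, and a state $W$ on $\mathcal H\otimes\mathcal H$ (a positive semidefinite operator of trace $1$) such that: 1. $\mathrm{tr}[W(A_i\otimes I)]=0$, $\mathrm{tr}[W(I\otimes B_j)]=0$ and $\mathrm{tr}[W(A_i\otimes B_j)]=\mathbf x_i\cdot\mathbf x_j$ for all $i,j$; in particular $\mathrm{tr}[W(A_i\otimes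 B_i)]=1$ for all $i$. 2. Every LHV model that recovers the perfect correlations, i.e. with $E(X_iY_i)=\mathrm{tr}[W(A_i\otimes B_i)]$ for all $i$, satisfies $X_i=Y_i$ almost surely for all $i$, and satisfies the Bell inequality $$\sum_{1\le i<j\le n} b_{ij}\,E(X_iY_j)\ \le\ \beta(b).$$ 3. $\beta(b)>0$, and the quantum correlations violate this inequality by a factor greater than $K$: $$\sum_{1\le i<j\le n} b_{ij}\,\mathrm{tr}[W(A_i\otimes B_j)]\ >\ K\,\beta(b).$$ Then there is a universal constant $c>0$ such that $\mathcal V(n,c\log n)$ holds for every $n\ge 2$. Consequently the violation is unbounded: for every $K\in\mathbb R$, $\mathcal V(n,K)$ holds for all sufficiently large $n$. -/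

import Mathlib

open MeasureTheory
open scoped Kronecker ComplexOrder

universe u

namespace BellViolation

/-- A traceless two-outcome observable on `ℂ^d`: a Hermitian operator with spectrum
`{1, -1}` and trace zero. -/
structure IsTracelessObservable {d : ℕ} (A : Matrix (Fin d) (Fin d) ℂ) : Prop where
  isHermitian : A.IsHermitian
  spectrum_eq : spectrum ℂ A = {1, -1}
  trace_eq_zero : A.trace = 0

/-- A (mixed) state on `ℂ^d ⊗ ℂ^d`: a positive semidefinite operator of trace one.
The space `ℂ^d ⊗ ℂ^d` is `ℂ^(Fin d × Fin d)`, and tensor products of operators are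
Kronecker products of matrices. -/
structure IsState {d : ℕ} (W : Matrix (Fin d × Fin d) (Fin d × Fin d) ℂ) : Prop where
  posSemidef : W.PosSemidef
  trace_eq_one : W.trace = 1

/-- The quantum expectation `tr[W (S ⊗ T)]`. -/
noncomputable def qExp {d : ℕ} (W : Matrix (Fin d × Fin d) (Fin d × Fin d) ℂ)
    (S T : Matrix (Fin d) (Fin d) ℂ) : ℂ :=
  (W * (S ⊗ₖ T)).trace

/-- Alice's observables `A i`, Bob's observables `B j` and the shared state `W` form a system
with vanishing one-sided expectations and with correlations `x i ⬝ x j`. -/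
structure IsRealization {n d : ℕ} (x : Fin n → EuclideanSpace ℝ (Fin n))
    (A B : Fin n → Matrix (Fin d) (Fin d) ℂ)
    (W : Matrix (Fin d × Fin d) (Fin d × Fin d) ℂ) : Prop where
  observable_left : ∀ i, IsTracelessObservable (A i)
  observable_right : ∀ j, IsTracelessObservable (B j)
  state : IsState W
  exp_left : ∀ i, qExp W (A i) 1 = 0
  exp_right : ∀ j, qExp W 1 (B j) = 0
  correlation : ∀ i j, qExp W (A i) (B j) = ((inner ℝ (x i) (x j) : ℝ) : ℂ)
  perfect : ∀ i, qExp W (A i) (B i) = 1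

/-- A (deterministic) local hidden variable model with `n` measurements on each side:
a probability measure on the space `Λ` of hidden variables and `±1`-valued random variables
`X i` (Alice) and `Y j` (Bob). -/
structure IsLHVModel {n : ℕ} {Λ : Type u} [MeasurableSpace Λ] (μ : Measure Λ)
    (X Y : Fin n → Λ → ℝ) : Prop where
  isProbabilityMeasure : IsProbabilityMeasure μ
  measurable_left : ∀ i, Measurable (X i)
  measurable_right : ∀ j, Measurable (Y j)
  values_left : ∀ i l, X i l = 1 ∨ X i l = -1
  values_right : ∀ j l, Y j l = 1 ∨ Y j l = -1

/-- The linear form `∑_{i < j} b i j * r i j` on correlation matrices `r`. -/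
noncomputable def bellForm {n : ℕ} (b r : Fin n → Fin n → ℝ) : ℝ :=
  ∑ i, ∑ j ∈ Finset.Ioi i, b i j * r i j

/-- `sup_{X_i = ±1} ∑_{i < j} b i j X_i X_j`; the signs are the units `1, -1` of `ℤ`. -/
noncomputable def classicalBound {n : ℕ} (b : Fin n → Fin n → ℝ) : ℝ :=
  ⨆ X : Fin n → ℤˣ, bellForm b fun i j => ((X i : ℤ) : ℝ) * ((X j : ℤ) : ℝ)

/-- With `n` measurements per side there are a quantum system and a Bell inequality
`∑_{i < j} b i j E(X_i Y_j) ≤ classicalBound b` such that every local hidden variable model that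
recovers the perfect correlations of the system has `X i = Y i` almost surely and satisfies the
inequality, while the quantum correlations violate it by a factor greater than `K`. -/
def ExistsViolation (n : ℕ) (K : ℝ) : Prop :=
  ∃ (b : Fin n → Fin n → ℝ) (x : Fin n → EuclideanSpace ℝ (Fin n)) (d : ℕ)
    (A B : Fin n → Matrix (Fin d) (Fin d) ℂ) (W : Matrix (Fin d × Fin d) (Fin d × Fin d) ℂ),
    (∀ i, ‖x i‖ = 1) ∧
    IsRealization x A B W ∧
    (∀ (Λ : Type u) [MeasurableSpace Λ] (μ : Measure Λ) (X Y : Fin n → Λ → ℝ),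
      IsLHVModel μ X Y →
      (∀ i, ((∫ l, X i l * Y i l ∂μ : ℝ) : ℂ) = qExp W (A i) (B i)) →
        (∀ i, X i =ᵐ[μ] Y i) ∧
        bellForm b (fun i j => ∫ l, X i l * Y j l ∂μ) ≤ classicalBound b) ∧
    0 < classicalBound b ∧
    K * classicalBound b < bellForm b fun i j => (qExp W (A i) (B j)).re

end BellViolation

/-! Tsirelson's construction realizes any unit vectors as quantum correlations, and perfect
correlations force `X i = Y i`. So it suffices to separate the quadratic form of `b` on unit vectors
from the same form on signs.

Take `N` unit vectors in `ℝ^d` forming a tight frame. Then `d` times their Gram matrix is `N` times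
the projection onto the linear functions `z ↦ ⟪w, v z⟫`. Subtracting `N - 1` from the diagonal gives
a kernel with value `‖f‖² - N · dist(f, linear functions)²` at `f`. The vectors `v z` themselves
have linear coordinates, so they give `N`. If the frame is also a net, a function bounded by `1` is
close to a linear function only when `‖w‖` is bounded, and its value is at most `16 N / d`
(`frame_form_le`). The gap is of order `d`.

A Bell form has no diagonal, while this kernel has a large negative one. Replacing each point by
many copies makes the diagonal negligible (`existsViolation_of_frame`). Directions of short lattice
points provide frames of exponential size in `d`, so `n` exponential in `d` suffices, whence the
logarithm. -/

namespace BellViolation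

/-! ### Quantum side: Clifford matrices and Tsirelson's realization -/

/-- There are `n` anticommuting traceless Hermitian involutions of a nonzero `ℂ^d`. -/
theorem exists_clifford_generators (n : ℕ) :
    ∃ (d : ℕ) (γ : Fin n → Matrix (Fin d) (Fin d) ℂ), 0 < d ∧ (∀ i, (γ i).IsHermitian) ∧
      (∀ i, (γ i).trace = 0) ∧ (∀ i, γ i * γ i = 1) ∧
      ∀ i j, i ≠ j → γ i * γ j + γ j * γ i = 0 := by
  induction n with
  | zero => exact ⟨1, fun i => i.elim0, one_pos, fun i => i.elim0, fun i => i.elim0,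
      fun i => i.elim0, fun i => i.elim0⟩
  | succ n ih =>
    obtain ⟨d, γ, hd, hH, ht, hs, ha⟩ := ih
    let Φ := Matrix.reindexAlgEquiv ℂ ℂ (finSumFinEquiv (m := d) (n := d))
    -- In block form these are `σ_z ⊗ 1` and `σ_x ⊗ γ i`; `Φ` transports them back to `Fin (d + d)`.
    let g : Fin (n + 1) → Matrix (Fin d ⊕ Fin d) (Fin d ⊕ Fin d) ℂ :=
      Fin.cons (Matrix.fromBlocks 1 0 0 (-1)) fun i => Matrix.fromBlocks 0 (γ i) (γ i) 0
    have g0 : g 0 = Matrix.fromBlocks 1 0 0 (-1) := rfl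
    have gs : ∀ i : Fin n, g i.succ = Matrix.fromBlocks 0 (γ i) (γ i) 0 := fun i => rfl
    have hgH : ∀ i, (g i).IsHermitian := by
      intro i
      refine Fin.cases ?_ (fun i => ?_) i
      · rw [g0]; simp [Matrix.IsHermitian, Matrix.fromBlocks_conjTranspose]
      · rw [gs]
        have := hH i
        rw [Matrix.IsHermitian] at this
        simp [Matrix.IsHermitian, Matrix.fromBlocks_conjTranspose, this]
    refine ⟨d + d, fun i => Φ (g i), by omega, fun i => ?_, fun i => ?_, fun i => ?_,
      fun i j hij => ?_⟩
    · exact (hgH i).submatrix _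
    · have h1 : (Φ (g i)).trace = (g i).trace := by
        simp only [Φ, Matrix.trace, Matrix.coe_reindexAlgEquiv, Matrix.diag, Matrix.reindex_apply,
          Matrix.submatrix_apply]
        exact Equiv.sum_comp finSumFinEquiv.symm fun k => g i k k
      rw [h1]
      refine Fin.cases ?_ (fun i => ?_) i
      · rw [g0]; simp [Matrix.trace, Fintype.sum_sum_type]
      · rw [gs]; simp [Matrix.trace, Fintype.sum_sum_type]
    · rw [← map_mul, ← map_one Φ]
      congr 1
      refine Fin.cases ?_ (fun i => ?_) i
      · rw [g0, Matrix.fromBlocks_multiply]; simp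
      · rw [gs, Matrix.fromBlocks_multiply]; simp [hs]
    · rw [← map_mul, ← map_mul, ← map_add, ← map_zero Φ]
      congr 1
      revert hij
      refine Fin.cases ?_ (fun i => ?_) i <;> refine Fin.cases ?_ (fun j => ?_) j <;> intro hij
      · exact absurd rfl hij
      · rw [g0, gs, Matrix.fromBlocks_multiply, Matrix.fromBlocks_multiply,
          Matrix.fromBlocks_add]; simp
      · rw [g0, gs, Matrix.fromBlocks_multiply, Matrix.fromBlocks_multiply,
          Matrix.fromBlocks_add]; simp
      · have := ha i j (fun h => hij (by rw [h]))
        rw [gs, gs, Matrix.fromBlocks_multiply, Matrix.fromBlocks_multiply,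
          Matrix.fromBlocks_add]
        simp [this]

/-- A traceless Hermitian involution is a traceless observable. -/
theorem isTracelessObservable_of_mul_self {d : ℕ} (hd : 0 < d) {A : Matrix (Fin d) (Fin d) ℂ}
    (hH : A.IsHermitian) (ht : A.trace = 0) (hs : A * A = 1) : IsTracelessObservable A := by
  have hd' : (d : ℂ) ≠ 0 := by exact_mod_cast hd.ne'
  refine ⟨hH, ?_, ht⟩
  -- If `c - A` were invertible, `(c - A)(c + A) = 0` would give `A = -c`, which has nonzero trace.
  have key : ∀ c : ℂ, c * c = 1 → c ∈ spectrum ℂ A := by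
    intro c hc
    rw [spectrum.mem_iff]
    intro hu
    have h0 : (algebraMap ℂ (Matrix (Fin d) (Fin d) ℂ) c - A) *
        (algebraMap ℂ (Matrix (Fin d) (Fin d) ℂ) c + A) = 0 := by
      rw [Algebra.algebraMap_eq_smul_one, sub_mul, mul_add, mul_add, hs]
      simp only [smul_mul_assoc, one_mul, mul_smul_comm, mul_one, smul_smul, hc, one_smul]
      abel
    have h1 := hu.mul_right_eq_zero.mp h0
    have h2 := congrArg Matrix.trace h1
    rw [Matrix.trace_add, ht, Algebra.algebraMap_eq_smul_one, Matrix.trace_smul,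
      Matrix.trace_one] at h2
    have hc0 : c ≠ 0 := by rintro rfl; simp at hc
    simp [hc0] at h2
    exact hd.ne' h2
  refine Set.Subset.antisymm (fun c hc => ?_) ?_
  · by_contra hne
    apply spectrum.mem_iff.mp hc
    have h2 : c * c - 1 ≠ 0 := by
      intro h
      have : (c - 1) * (c + 1) = 0 := by linear_combination h
      rcases mul_eq_zero.mp this with h | h
      · exact hne (Or.inl (sub_eq_zero.mp h))
      · exact hne (Or.inr (eq_neg_of_add_eq_zero_left h))
    refine IsUnit.of_mul_eq_one ((c * c - 1)⁻¹ • (algebraMap ℂ _ c + A)) ?_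
    rw [Algebra.algebraMap_eq_smul_one, mul_smul_comm, sub_mul, mul_add, mul_add, hs]
    have : c • (1 : Matrix (Fin d) (Fin d) ℂ) * c • 1 + c • 1 * A - (A * c • 1 + 1)
        = (c * c - 1) • 1 := by
      simp only [smul_mul_assoc, one_mul, mul_smul_comm, mul_one, smul_smul, sub_smul, one_smul]
      abel
    rw [this, smul_smul, inv_mul_cancel₀ h2, one_smul]
  · rintro c (rfl | rfl)
    · exact key 1 (by ring)
    · exact key (-1) (by ring)

/-- The maximally entangled state on `ℂ^d ⊗ ℂ^d`. -/
noncomputable def maxEntangled (d : ℕ) : Matrix (Fin d × Fin d) (Fin d × Fin d) ℂ :=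
  (d : ℂ)⁻¹ • Matrix.vecMulVec (fun p => if p.1 = p.2 then 1 else 0)
    (star fun p => if p.1 = p.2 then 1 else 0)

theorem qExp_maxEntangled {d : ℕ} (S T : Matrix (Fin d) (Fin d) ℂ) :
    qExp (maxEntangled d) S T = (d : ℂ)⁻¹ * (S * T.transpose).trace := by
  simp only [qExp, maxEntangled, Matrix.smul_mul, Matrix.trace_smul, smul_eq_mul]
  congr 1
  simp only [Matrix.trace, Matrix.diag, Matrix.mul_apply, Matrix.vecMulVec_apply,
    Matrix.kroneckerMap_apply, Fintype.sum_prod_type, Matrix.transpose_apply, Pi.star_apply]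
  simp only [apply_ite star, star_one, star_zero, mul_ite, mul_one, mul_zero, ite_mul, zero_mul,
    Finset.sum_ite_eq, Finset.mem_univ, if_true, one_mul]
  rw [Finset.sum_comm]
  simp only [Finset.sum_ite_irrel, Finset.sum_const_zero, Finset.sum_ite_eq',
    Finset.mem_univ, if_true]
  exact Finset.sum_comm

theorem isState_maxEntangled {d : ℕ} (hd : 0 < d) : IsState (maxEntangled d) := by
  have hd' : (d : ℂ) ≠ 0 := by exact_mod_cast hd.ne'
  refine ⟨?_, ?_⟩
  · refine (Matrix.posSemidef_vecMulVec_self_star _).smul ?_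
    positivity
  · have := qExp_maxEntangled (1 : Matrix (Fin d) (Fin d) ℂ) 1
    simpa [qExp, hd'] using this

/-- Tsirelson's construction: all unit vectors are realized by quantum correlations. -/
theorem exists_isRealization {n : ℕ} (x : Fin n → EuclideanSpace ℝ (Fin n))
    (hx : ∀ i, ‖x i‖ = 1) :
    ∃ (d : ℕ) (A B : Fin n → Matrix (Fin d) (Fin d) ℂ)
      (W : Matrix (Fin d × Fin d) (Fin d × Fin d) ℂ), IsRealization x A B W := by
  obtain ⟨d, γ, hd, hH, ht, hs, ha⟩ := exists_clifford_generators n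
  have hd' : (d : ℂ) ≠ 0 := by exact_mod_cast hd.ne'
  let A : Fin n → Matrix (Fin d) (Fin d) ℂ := fun i => ∑ k, (x i k : ℂ) • γ k
  have hAH : ∀ i, (A i).IsHermitian := by
    intro i
    simp only [A, Matrix.IsHermitian, Matrix.conjTranspose_sum, Matrix.conjTranspose_smul]
    refine Finset.sum_congr rfl fun k _ => ?_
    rw [(hH k).eq]; simp
  have hAt : ∀ i, (A i).trace = 0 := by
    intro i
    simp [A, Matrix.trace_sum, Matrix.trace_smul, ht]
  have hanti : ∀ i j, A i * A j + A j * A i = (2 * ((inner ℝ (x i) (x j) : ℝ) : ℂ)) • 1 := by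
    intro i j
    have e1 : A i * A j = ∑ k, ∑ l, ((x i k : ℂ) * (x j l : ℂ)) • (γ k * γ l) := by
      simp only [A, Finset.sum_mul_sum, smul_mul_smul_comm]
    have e2 : A j * A i = ∑ k, ∑ l, ((x i k : ℂ) * (x j l : ℂ)) • (γ l * γ k) := by
      simp only [A, Finset.sum_mul_sum, smul_mul_smul_comm]
      rw [Finset.sum_comm]
      refine Finset.sum_congr rfl fun k _ => Finset.sum_congr rfl fun l _ => ?_
      rw [mul_comm]
    have e3 : ∀ k l, γ k * γ l + γ l * γ k = if k = l then (2 : ℂ) • 1 else 0 := by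
      intro k l
      split_ifs with h
      · subst h; rw [hs, two_smul]
      · exact ha k l h
    rw [e1, e2, ← Finset.sum_add_distrib]
    simp only [← Finset.sum_add_distrib, ← smul_add, e3, smul_ite, smul_zero, Finset.sum_ite_eq,
      Finset.mem_univ, if_true, smul_smul]
    rw [← Finset.sum_smul, PiLp.inner_apply]
    congr 1
    push_cast
    rw [Finset.mul_sum]
    refine Finset.sum_congr rfl fun k _ => ?_
    simp only [RCLike.inner_apply, conj_trivial, Complex.ofReal_mul]
    ring
  have hAs : ∀ i, A i * A i = 1 := by
    intro i
    have h := hanti i i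
    rw [real_inner_self_eq_norm_sq, hx i, ← two_smul ℂ] at h
    have := congrArg (fun M => (2 : ℂ)⁻¹ • M) h
    simpa [smul_smul] using this
  have htr : ∀ i j, (A i * A j).trace = d * ((inner ℝ (x i) (x j) : ℝ) : ℂ) := by
    intro i j
    have h := congrArg Matrix.trace (hanti i j)
    rw [Matrix.trace_add, Matrix.trace_mul_comm (A j), Matrix.trace_smul, Matrix.trace_one,
      Fintype.card_fin, smul_eq_mul] at h
    linear_combination h / 2
  have hobs : ∀ i, IsTracelessObservable (A i) := fun i =>
    isTracelessObservable_of_mul_self hd (hAH i) (hAt i) (hAs i)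
  have hcorr : ∀ i j, qExp (maxEntangled d) (A i) (A j).transpose =
      ((inner ℝ (x i) (x j) : ℝ) : ℂ) := by
    intro i j
    rw [qExp_maxEntangled, Matrix.transpose_transpose, htr, inv_mul_cancel_left₀ hd']
  -- Bob's transposes cancel the transpose in `qExp_maxEntangled`, leaving the normalized trace of
  -- `A i * A j`.
  refine ⟨d, A, fun j => (A j).transpose, maxEntangled d, hobs, fun j => ?_,
    isState_maxEntangled hd, fun i => ?_, fun j => ?_, hcorr, fun i => ?_⟩
  · refine isTracelessObservable_of_mul_self hd (hAH j).transpose ?_ ?_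
    · rw [Matrix.trace_transpose, hAt]
    · rw [← Matrix.transpose_mul, hAs, Matrix.transpose_one]
  · rw [qExp_maxEntangled]; simp [hAt]
  · rw [qExp_maxEntangled]; simp [hAt]
  · rw [hcorr, real_inner_self_eq_norm_sq, hx i]; simp

/-! ### Classical side, and reduction to unit vectors -/

theorem bellForm_le_classicalBound {n : ℕ} (b : Fin n → Fin n → ℝ) (X : Fin n → ℤˣ) :
    bellForm b (fun i j => ((X i : ℤ) : ℝ) * ((X j : ℤ) : ℝ)) ≤ classicalBound b :=
  le_ciSup (f := fun X : Fin n → ℤˣ => bellForm b fun i j => ((X i : ℤ) : ℝ) * ((X j : ℤ) : ℝ))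
    (Set.finite_range _).bddAbove X

/-- In a local hidden variable model, perfect correlation means almost sure equality. -/
theorem IsLHVModel.ae_eq {n : ℕ} {Λ : Type u} [MeasurableSpace Λ] {μ : Measure Λ}
    {X Y : Fin n → Λ → ℝ} (h : IsLHVModel μ X Y) (i : Fin n) (hi : ∫ l, X i l * Y i l ∂μ = 1) :
    X i =ᵐ[μ] Y i := by
  have := h.isProbabilityMeasure
  have hint : Integrable (fun l => X i l * Y i l) μ := by
    refine Integrable.of_bound ((h.measurable_left i).mul (h.measurable_right i)).aestronglyMeasurable
      1 (Filter.Eventually.of_forall fun l => ?_)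
    rcases h.values_left i l with h1 | h1 <;> rcases h.values_right i l with h2 | h2 <;>
      simp [h1, h2]
  have h0 : ∫ l, (1 - X i l * Y i l) ∂μ = 0 := by
    rw [integral_sub (integrable_const _) hint, hi]; simp
  have hnn : 0 ≤ fun l => 1 - X i l * Y i l := by
    intro l
    rcases h.values_left i l with h1 | h1 <;> rcases h.values_right i l with h2 | h2 <;>
      simp [h1, h2]
  have hae := (integral_eq_zero_iff_of_nonneg hnn ((integrable_const _).sub hint)).mp h0
  filter_upwards [hae] with l hl
  rcases h.values_left i l with h1 | h1 <;> rcases h.values_right i l with h2 | h2 <;>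
    simp [h1, h2] at hl ⊢

/-- The Bell inequality for perfectly correlated local hidden variable models. -/
theorem IsLHVModel.bellForm_le {n : ℕ} {Λ : Type u} [MeasurableSpace Λ] {μ : Measure Λ}
    {X Y : Fin n → Λ → ℝ} (h : IsLHVModel μ X Y) (hXY : ∀ i, X i =ᵐ[μ] Y i)
    (b : Fin n → Fin n → ℝ) :
    bellForm b (fun i j => ∫ l, X i l * Y j l ∂μ) ≤ classicalBound b := by
  have := h.isProbabilityMeasure
  have hint : ∀ i j, Integrable (fun l => X i l * X j l) μ := by
    intro i j
    refine Integrable.of_bound ((h.measurable_left i).mul (h.measurable_left j)).aestronglyMeasurable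
      1 (Filter.Eventually.of_forall fun l => ?_)
    rcases h.values_left i l with h1 | h1 <;> rcases h.values_left j l with h2 | h2 <;>
      simp [h1, h2]
  -- With `Y j` replaced by `X j`, the Bell expression averages forms evaluated at one sign vector
  -- per hidden variable.
  have hE : ∀ i j, ∫ l, X i l * Y j l ∂μ = ∫ l, X i l * X j l ∂μ := by
    intro i j
    refine integral_congr_ae ?_
    filter_upwards [hXY j] with l hl
    rw [hl]
  have hsum : bellForm b (fun i j => ∫ l, X i l * Y j l ∂μ) =
      ∫ l, bellForm b (fun i j => X i l * X j l) ∂μ := by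
    simp only [bellForm, hE]
    rw [integral_finsetSum _ fun i _ => integrable_finsetSum _ fun j _ => (hint i j).const_mul _]
    refine Finset.sum_congr rfl fun i _ => ?_
    rw [integral_finsetSum _ fun j _ => (hint i j).const_mul _]
    refine Finset.sum_congr rfl fun j _ => ?_
    rw [integral_const_mul]
  have hle : ∀ l, bellForm b (fun i j => X i l * X j l) ≤ classicalBound b := by
    intro l
    have hs : ∀ i, ∃ s : ℤˣ, ((s : ℤ) : ℝ) = X i l := by
      intro i
      rcases h.values_left i l with h1 | h1
      · exact ⟨1, by simp [h1]⟩
      · exact ⟨-1, by simp [h1]⟩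
    choose s hs using hs
    simpa only [hs] using bellForm_le_classicalBound b s
  rw [hsum]
  calc ∫ l, bellForm b (fun i j => X i l * X j l) ∂μ ≤ ∫ _, classicalBound b ∂μ := by
        refine integral_mono ?_ (integrable_const _) hle
        exact integrable_finsetSum _ fun i _ => integrable_finsetSum _ fun j _ =>
          (hint i j).const_mul _
    _ = classicalBound b := by simp

/-- Operators, states and hidden variables disappear here: what remains is a Grothendieck-type
inequality for `b` and unit vectors. -/
theorem existsViolation_of_unit_vectors {n : ℕ} {K : ℝ} (b : Fin n → Fin n → ℝ)
    (x : Fin n → EuclideanSpace ℝ (Fin n)) (hx : ∀ i, ‖x i‖ = 1) (hb : 0 < classicalBound b)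
    (hK : K * classicalBound b < bellForm b fun i j => inner ℝ (x i) (x j)) :
    ExistsViolation.{u} n K := by
  obtain ⟨d, A, B, W, h⟩ := exists_isRealization x hx
  refine ⟨b, x, d, A, B, W, hx, h, ?_, hb, by simpa only [h.correlation, Complex.ofReal_re]⟩
  intro Λ _ μ X Y hM hp
  have hae : ∀ i, X i =ᵐ[μ] Y i := fun i => hM.ae_eq i (by
    have := hp i
    rw [h.perfect i] at this
    exact_mod_cast this)
  exact ⟨hae, hM.bellForm_le hae b⟩

theorem ExistsViolation.mono {n : ℕ} {K K' : ℝ} (h : ExistsViolation.{u} n K) (hK : K' ≤ K) :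
    ExistsViolation.{u} n K' := by
  obtain ⟨b, x, d, A, B, W, h1, h2, h3, h4, h5⟩ := h
  exact ⟨b, x, d, A, B, W, h1, h2, h3, h4, (mul_le_mul_of_nonneg_right hK h4.le).trans_lt h5⟩

/-! ### From symmetric kernels to Bell inequalities -/

theorem two_mul_bellForm {n : ℕ} (b r : Fin n → Fin n → ℝ) (hb : ∀ i j, b i j = b j i)
    (hr : ∀ i j, r i j = r j i) :
    2 * bellForm b r = ∑ i, ∑ j, b i j * r i j - ∑ i, b i i * r i i := by
  have h1 : bellForm b r = ∑ i, ∑ j, if i < j then b i j * r i j else 0 := by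
    simp only [bellForm]
    refine Finset.sum_congr rfl fun i _ => ?_
    rw [← Finset.sum_filter]
    refine Finset.sum_congr ?_ fun _ _ => rfl
    ext j; simp
  have h2 : bellForm b r = ∑ i, ∑ j, if j < i then b i j * r i j else 0 := by
    rw [h1, Finset.sum_comm]
    refine Finset.sum_congr rfl fun i _ => Finset.sum_congr rfl fun j _ => ?_
    rw [hb, hr]
  have h3 : ∑ i, b i i * r i i = ∑ i, ∑ j, if i = j then b i j * r i j else 0 := by simp
  rw [two_mul]
  nth_rewrite 1 [h1]
  rw [h2, h3, eq_sub_iff_add_eq, ← Finset.sum_add_distrib, ← Finset.sum_add_distrib]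
  refine Finset.sum_congr rfl fun i _ => ?_
  rw [← Finset.sum_add_distrib, ← Finset.sum_add_distrib]
  refine Finset.sum_congr rfl fun j _ => ?_
  rcases lt_trichotomy i j with h | h | h
  · simp [h, h.not_gt, h.ne]
  · simp [h]
  · simp [h, h.not_gt, h.ne']

/-- A symmetric kernel `B` on a finite type that embeds into `Fin n`, read as a Bell inequality
for the off-diagonal entries. -/
theorem existsViolation_of_kernel {n k : ℕ} (hk : k ≤ n) {s : Type*} [Fintype s] (e : s ↪ Fin n)
    (B : s → s → ℝ) (hB : ∀ p q, B p q = B q p) (v : s → EuclideanSpace ℝ (Fin k))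
    (hv : ∀ p, ‖v p‖ = 1) {K β : ℝ} (hK0 : 0 ≤ K)
    (hβ : ∀ ε : s → ℤˣ, ∑ p, ∑ q, B p q * (((ε p : ℤ) : ℝ) * ((ε q : ℤ) : ℝ)) - ∑ p, B p p ≤ β)
    (hpos : ∃ ε : s → ℤˣ,
      0 < ∑ p, ∑ q, B p q * (((ε p : ℤ) : ℝ) * ((ε q : ℤ) : ℝ)) - ∑ p, B p p)
    (hK : K * β < ∑ p, ∑ q, B p q * inner ℝ (v p) (v q) - ∑ p, B p p) :
    ExistsViolation.{u} n K := by
  classical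
  obtain ⟨ε₀, hε₀⟩ := hpos
  have hne : Nonempty s := by
    by_contra h
    rw [not_nonempty_iff] at h
    simp at hε₀
  obtain ⟨p₀⟩ := hne
  -- The kernel is pushed forward along `e`, so signs and vectors outside the range of `e` affect no
  -- form and may be chosen freely.
  let b : Fin n → Fin n → ℝ := fun i j => ∑ p, ∑ q, if e p = i then if e q = j then B p q else 0 else 0
  have hb : ∀ i j, b i j = b j i := by
    intro i j
    simp only [b]
    rw [Finset.sum_comm]
    refine Finset.sum_congr rfl fun p _ => Finset.sum_congr rfl fun q _ => ?_
    rw [hB]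
    split_ifs <;> rfl
  have hform : ∀ r : Fin n → Fin n → ℝ, (∀ i j, r i j = r j i) → (∀ i, r i i = 1) →
      2 * bellForm b r = ∑ p, ∑ q, B p q * r (e p) (e q) - ∑ p, B p p := by
    intro r hr hr1
    rw [two_mul_bellForm b r hb hr]
    congr 1
    · have : ∀ i, ∑ j, b i j * r i j = ∑ p, ∑ q, ∑ j,
          if e p = i then if e q = j then B p q * r i j else 0 else 0 := by
        intro i
        simp only [b, Finset.sum_mul, ite_mul, zero_mul]
        rw [Finset.sum_comm]
        refine Finset.sum_congr rfl fun p _ => ?_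
        rw [Finset.sum_comm]
      simp only [this]
      rw [Finset.sum_comm]
      refine Finset.sum_congr rfl fun p _ => ?_
      rw [Finset.sum_comm]
      refine Finset.sum_congr rfl fun q _ => ?_
      rw [Finset.sum_comm]
      simp
    · simp only [hr1, mul_one, b]
      rw [Finset.sum_comm]
      refine Finset.sum_congr rfl fun p _ => ?_
      rw [Finset.sum_comm]
      simp
  have hsq : ∀ t : ℤˣ, ((t : ℤ) : ℝ) * ((t : ℤ) : ℝ) = 1 := by
    intro t
    rcases Int.units_eq_one_or t with h | h <;> simp [h]
  have hsign : ∀ X : Fin n → ℤˣ,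
      2 * bellForm b (fun i j => ((X i : ℤ) : ℝ) * ((X j : ℤ) : ℝ)) =
      ∑ p, ∑ q, B p q * (((X (e p) : ℤ) : ℝ) * ((X (e q) : ℤ) : ℝ)) - ∑ p, B p p := fun X =>
    hform _ (fun i j => mul_comm _ _) fun i => hsq _
  have hle : 2 * classicalBound b ≤ β := by
    have : classicalBound b ≤ β / 2 := ciSup_le fun X => by
      have h1 := hsign X
      have h2 := hβ fun p => X (e p)
      linarith
    linarith
  have hcpos : 0 < classicalBound b := by
    have h1 := hsign (Function.extend e ε₀ 1)
    simp only [e.injective.extend_apply] at h1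
    have h2 := bellForm_le_classicalBound b (Function.extend e ε₀ 1)
    linarith
  let T : EuclideanSpace ℝ (Fin k) →ₗᵢ[ℝ] EuclideanSpace ℝ (Fin n) :=
    LinearMap.isometryOfOrthonormal
      ((EuclideanSpace.basisFun (Fin k) ℝ).toBasis.constr ℝ
        fun i => EuclideanSpace.basisFun (Fin n) ℝ (Fin.castLE hk i))
      (v := (EuclideanSpace.basisFun (Fin k) ℝ).toBasis)
      (by simp)
      (by
        have : (⇑((EuclideanSpace.basisFun (Fin k) ℝ).toBasis.constr ℝ
            fun i => EuclideanSpace.basisFun (Fin n) ℝ (Fin.castLE hk i)) ∘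
            ⇑(EuclideanSpace.basisFun (Fin k) ℝ).toBasis) =
            fun i => EuclideanSpace.basisFun (Fin n) ℝ (Fin.castLE hk i) := by
          funext i
          exact Module.Basis.constr_basis _ _ _ _
        rw [this]
        exact (EuclideanSpace.basisFun (Fin n) ℝ).orthonormal.comp _ (Fin.castLE_injective hk))
  let x : Fin n → EuclideanSpace ℝ (Fin n) :=
    Function.extend e (fun p => T (v p)) fun _ => T (v p₀)
  have hxe : ∀ p, x (e p) = T (v p) := fun p => e.injective.extend_apply _ _ p
  have hx : ∀ i, ‖x i‖ = 1 := by
    intro i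
    by_cases h : ∃ p, e p = i
    · obtain ⟨p, rfl⟩ := h
      rw [hxe, T.norm_map, hv]
    · simp only [x]
      rw [Function.extend_apply' _ _ _ h, T.norm_map, hv]
  refine existsViolation_of_unit_vectors b x hx hcpos ?_
  have h1 := hform (fun i j => inner ℝ (x i) (x j)) (fun i j => real_inner_comm _ _)
    fun i => by rw [real_inner_self_eq_norm_sq, hx i, one_pow]
  simp only [hxe, T.inner_map_map] at h1
  have h2 : K * (2 * classicalBound b) ≤ K * β := mul_le_mul_of_nonneg_left hle hK0
  linarith

/-! ### Tight frames that are nets -/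

/-- A tight frame of unit vectors that is also a net of the sphere: quadratic forms in
functions with values in `[-1, 1]`. -/
theorem frame_form_le {ι : Type*} [Fintype ι] {d : ℕ} (hd : 0 < d)
    (v : ι → EuclideanSpace ℝ (Fin d))
    (hframe : ∀ w : EuclideanSpace ℝ (Fin d),
      d * ∑ z, inner ℝ w (v z) ^ 2 = Fintype.card ι * ‖w‖ ^ 2)
    (hnet : ∀ w : EuclideanSpace ℝ (Fin d), ∃ z, ‖w‖ / 2 ≤ inner ℝ w (v z))
    (f : ι → ℝ) (hf : ∀ z, |f z| ≤ 1) :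
    d * ‖∑ z, f z • v z‖ ^ 2 - (Fintype.card ι - 1) * ∑ z, f z ^ 2 ≤
      16 * Fintype.card ι / d := by
  obtain ⟨z₀, -⟩ := hnet 0
  set N : ℝ := (Fintype.card ι : ℝ) with hN
  have hNpos : 0 < N := by
    have : 0 < Fintype.card ι := Fintype.card_pos_iff.mpr ⟨z₀⟩
    rw [hN]; exact_mod_cast this
  have hN1 : 1 ≤ N := by
    have : 1 ≤ Fintype.card ι := Fintype.card_pos_iff.mpr ⟨z₀⟩
    rw [hN]; exact_mod_cast this
  have hD : (0 : ℝ) < d := by exact_mod_cast hd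
  set F := ∑ z, f z ^ 2 with hF
  have hFN : F ≤ N := by
    calc F ≤ ∑ _z : ι, (1 : ℝ) := Finset.sum_le_sum fun z _ => (sq_le_one_iff_abs_le_one _).mpr (hf z)
      _ = N := by simp [hN]
  set g := ∑ z, f z • v z with hg
  -- By tightness, `z ↦ ⟪w, v z⟫` is the orthogonal projection of `f` onto the linear functions;
  -- `hexp` is the squared distance.
  set w := (d / N) • g with hw
  have hgw : g = (N / d) • w := by
    rw [hw, smul_smul, div_mul_div_comm, mul_comm N, div_self (by positivity), one_smul]
  have hwg : inner ℝ w g = N / d * ‖w‖ ^ 2 := by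
    rw [hgw, inner_smul_right, real_inner_self_eq_norm_sq]
  have hgn : d * ‖g‖ ^ 2 = N ^ 2 / d * ‖w‖ ^ 2 := by
    rw [hgw, norm_smul, mul_pow, Real.norm_eq_abs, sq_abs]
    field_simp
  have hexp : ∑ z, (f z - inner ℝ w (v z)) ^ 2 = F - N / d * ‖w‖ ^ 2 := by
    have h1 : ∑ z, f z * inner ℝ w (v z) = N / d * ‖w‖ ^ 2 := by
      rw [← hwg, hg, inner_sum]
      simp [inner_smul_right]
    have h2 : ∑ z, inner ℝ w (v z) ^ 2 = N / d * ‖w‖ ^ 2 := by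
      have := hframe w
      field_simp
      linarith
    simp only [sub_sq, Finset.sum_add_distrib, Finset.sum_sub_distrib, mul_assoc,
      ← Finset.mul_sum, h1, h2]
    ring
  rw [hgn]
  have hrew : N ^ 2 / d * ‖w‖ ^ 2 - (N - 1) * F = F - N * (F - N / d * ‖w‖ ^ 2) := by
    field_simp; ring
  -- For `‖w‖ < 4` the projected part contributes at most `16 N / d` and the residual only lowers
  -- the value. Otherwise the net gives a point with `⟪w, v z⟫ ≥ 2` while `f z ≤ 1`, so the residual
  -- is at least `1` and the value at most `F - N ≤ 0`.
  rcases lt_or_ge ‖w‖ 4 with h4 | h4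
  · have hnn : 0 ≤ F - N / d * ‖w‖ ^ 2 := by
      rw [← hexp]; exact Finset.sum_nonneg fun _ _ => sq_nonneg _
    have h16 : ‖w‖ ^ 2 ≤ 16 := by nlinarith [norm_nonneg w]
    have h5 : N / d * ‖w‖ ^ 2 ≤ N / d * 16 := mul_le_mul_of_nonneg_left h16 (by positivity)
    have h6 : N / d * 16 = 16 * N / d := by ring
    have h7 := mul_nonneg (sub_nonneg.mpr hN1) hnn
    rw [hrew]
    linarith
  · obtain ⟨z, hz⟩ := hnet w
    have h1 : 1 ≤ (f z - inner ℝ w (v z)) ^ 2 := by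
      have := (abs_le.mp (hf z)).2
      nlinarith
    have h2 : 1 ≤ F - N / d * ‖w‖ ^ 2 := by
      rw [← hexp]
      exact h1.trans (Finset.single_le_sum (f := fun z => (f z - inner ℝ w (v z)) ^ 2)
        (fun _ _ => sq_nonneg _) (Finset.mem_univ z))
    have h3 : 0 ≤ 16 * N / d := by positivity
    rw [hrew]
    nlinarith

/-- With `c` copies of each point, the full form scales as `c ^ 2` but its diagonal only as `c`.
Averaging signs over copies yields functions with values in `[-1, 1]`, to which `frame_form_le`
applies. -/
theorem existsViolation_of_frame {ι : Type*} [Fintype ι] {d n : ℕ} (hd : 0 < d)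
    (v : ι → EuclideanSpace ℝ (Fin d)) (hv : ∀ z, ‖v z‖ = 1)
    (hframe : ∀ w : EuclideanSpace ℝ (Fin d),
      d * ∑ z, inner ℝ w (v z) ^ 2 = Fintype.card ι * ‖w‖ ^ 2)
    (hnet : ∀ w : EuclideanSpace ℝ (Fin d), ∃ z, ‖w‖ / 2 ≤ inner ℝ w (v z))
    (hcard : d + 1 < Fintype.card ι) (hn : 2 * d * Fintype.card ι ^ 2 ≤ n) :
    ExistsViolation.{u} n (d / 18) := by
  classical
  let κ := Fin (d * Fintype.card ι) × Bool
  have hκ : Fintype.card κ = 2 * (d * Fintype.card ι) := by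
    simp [κ, mul_comm]
  have hdn : d ≤ n := by
    refine le_trans ?_ hn
    have : 1 ≤ 2 * Fintype.card ι ^ 2 := by
      have : 0 < Fintype.card ι := by omega
      have := Nat.pow_pos (n := 2) this
      omega
    calc d = d * 1 := (mul_one d).symm
      _ ≤ d * (2 * Fintype.card ι ^ 2) := Nat.mul_le_mul_left _ this
      _ = 2 * d * Fintype.card ι ^ 2 := by ring
  obtain ⟨e⟩ : Nonempty ((ι × κ) ↪ Fin n) := by
    rw [Function.Embedding.nonempty_iff_card_le, Fintype.card_prod, hκ, Fintype.card_fin]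
    refine le_trans (le_of_eq ?_) hn
    ring
  set N : ℝ := (Fintype.card ι : ℝ) with hN
  have hD : (1 : ℝ) ≤ d := by exact_mod_cast hd
  have hNd : (d : ℝ) + 1 < N := by rw [hN]; exact_mod_cast hcard
  set c : ℝ := (Fintype.card κ : ℝ) with hc
  have hc2 : c = 2 * (d * N) := by rw [hc, hκ]; push_cast; rfl
  have hNpos : 0 < N := by linarith
  have hcpos : 0 < c := by rw [hc2]; positivity
  let M : ι → ι → ℝ := fun z z' => d * inner ℝ (v z) (v z') - if z = z' then N - 1 else 0
  have hMform : ∀ f : ι → ℝ, ∑ z, ∑ z', M z z' * (f z * f z') =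
      d * ‖∑ z, f z • v z‖ ^ 2 - (N - 1) * ∑ z, f z ^ 2 := by
    intro f
    rw [← real_inner_self_eq_norm_sq, sum_inner]
    simp only [inner_sum, inner_smul_left, inner_smul_right, M, sub_mul _ _ (f _ * f _),
      Finset.sum_sub_distrib, ite_mul, zero_mul, Finset.sum_ite_eq,
      Finset.mem_univ, if_true, Finset.mul_sum, conj_trivial]
    congr 1
    · refine Finset.sum_congr rfl fun z _ => Finset.sum_congr rfl fun z' _ => ?_
      ring
    · rw [← Finset.sum_sub_distrib]
      refine Finset.sum_congr rfl fun z _ => ?_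
      ring
  have hMdiag : ∀ z, M z z = d - (N - 1) := by
    intro z
    simp only [M, if_true, real_inner_self_eq_norm_sq, hv, one_pow, mul_one]
  have hMvec : ∑ z, ∑ z', M z z' * inner ℝ (v z) (v z') = N := by
    have : ∀ z, ∑ z', M z z' * inner ℝ (v z) (v z') = N - (N - 1) := by
      intro z
      simp only [M, sub_mul, Finset.sum_sub_distrib, ite_mul, zero_mul, Finset.sum_ite_eq,
        Finset.mem_univ, if_true, real_inner_self_eq_norm_sq, hv, one_pow, mul_one]
      have h := hframe (v z)
      rw [hv, one_pow, mul_one, Finset.mul_sum] at h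
      rw [← h]
      congr 1
      refine Finset.sum_congr rfl fun z' _ => ?_
      ring
    simp only [this, Finset.sum_const, Finset.card_univ, nsmul_eq_mul, ← hN]
    ring
  have hdiag : ∑ p : ι × κ, M p.1 p.1 = c * N * (d - (N - 1)) := by
    simp only [hMdiag, Finset.sum_const, Finset.card_univ, Fintype.card_prod, nsmul_eq_mul]
    push_cast
    rw [← hN, ← hc]
    ring
  have hsum : ∀ ε : ι × κ → ℤˣ,
      ∑ p : ι × κ, ∑ q : ι × κ, M p.1 q.1 * (((ε p : ℤ) : ℝ) * ((ε q : ℤ) : ℝ)) =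
      ∑ z, ∑ z', M z z' * ((∑ k, ((ε (z, k) : ℤ) : ℝ)) * ∑ k, ((ε (z', k) : ℤ) : ℝ)) := by
    intro ε
    rw [Fintype.sum_prod_type]
    refine Finset.sum_congr rfl fun z _ => ?_
    simp only [Fintype.sum_prod_type (γ := ℝ) (α₁ := ι) (α₂ := κ)]
    rw [Finset.sum_comm]
    refine Finset.sum_congr rfl fun z' _ => ?_
    rw [Finset.sum_mul_sum, Finset.mul_sum]
    refine Finset.sum_congr rfl fun k _ => ?_
    rw [Finset.mul_sum]
  -- In `β`, `16` comes from `frame_form_le` and `1` from the removed diagonal, as `c = 2 d N` is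
  -- large enough.
  refine existsViolation_of_kernel hdn e (fun p q => M p.1 q.1) (fun p q => ?_)
    (fun p => v p.1) (fun p => hv p.1) (K := d / 18) (β := 17 * c ^ 2 * N / d) (by positivity)
    (fun ε => ?_) ⟨fun p => if p.2.2 then 1 else -1, ?_⟩ ?_
  · simp only [M, real_inner_comm, eq_comm]
  · rw [hsum, hdiag]
    have h := frame_form_le hd v hframe hnet (fun z => c⁻¹ * ∑ k, ((ε (z, k) : ℤ) : ℝ)) (by
      intro z
      rw [abs_mul, abs_of_pos (inv_pos.mpr hcpos), inv_mul_le_iff₀ hcpos, mul_one]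
      refine (Finset.abs_sum_le_sum_abs _ _).trans (le_of_eq ?_)
      have : ∀ t : ℤˣ, |((t : ℤ) : ℝ)| = 1 := by
        intro t
        rcases Int.units_eq_one_or t with h | h <;> simp [h]
      simp [this, hc])
    rw [← hN, ← hMform] at h
    have h2 : ∑ z, ∑ z', M z z' * ((c⁻¹ * ∑ k, ((ε (z, k) : ℤ) : ℝ)) *
        (c⁻¹ * ∑ k, ((ε (z', k) : ℤ) : ℝ))) = (c ^ 2)⁻¹ *
        ∑ z, ∑ z', M z z' * ((∑ k, ((ε (z, k) : ℤ) : ℝ)) * ∑ k, ((ε (z', k) : ℤ) : ℝ)) := by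
      simp only [Finset.mul_sum (s := (Finset.univ : Finset ι))]
      refine Finset.sum_congr rfl fun z _ => Finset.sum_congr rfl fun z' _ => ?_
      rw [← inv_pow]
      ring
    rw [h2, inv_mul_le_iff₀ (by positivity)] at h
    have h3 : c * N * (N - 1 - d) ≤ c ^ 2 * N / d := by
      rw [le_div_iff₀ (by positivity)]
      have : (N - 1 - d) * d ≤ c := by rw [hc2]; nlinarith
      calc c * N * (N - 1 - d) * d = c * N * ((N - 1 - d) * d) := by ring
        _ ≤ c * N * c := mul_le_mul_of_nonneg_left this (by positivity)
        _ = c ^ 2 * N := by ring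
    have h4 : c ^ 2 * (16 * N / d) + c ^ 2 * N / d = 17 * c ^ 2 * N / d := by ring
    linarith
  -- Signs balanced on each set of copies kill the full form, leaving minus the diagonal, positive
  -- because `d + 1 < N`.
  · rw [hsum, hdiag]
    have h0 : ∀ z : ι, ∑ k : κ, (((if ((z, k) : ι × κ).2.2 = true then (1 : ℤˣ) else -1 : ℤˣ) : ℤ) : ℝ) = 0 := by
      intro z
      simp [κ, Fintype.sum_prod_type]
    simp only [h0]
    simp only [mul_zero, Finset.sum_const_zero, zero_sub]
    have : 0 < c * N * (N - 1 - d) := by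
      have : 0 < N - 1 - d := by linarith
      positivity
    linarith
  · rw [hdiag]
    have h1 : ∑ p : ι × κ, ∑ q : ι × κ, M p.1 q.1 * inner ℝ (v p.1) (v q.1) = c ^ 2 * N := by
      rw [← hMvec, Fintype.sum_prod_type, Finset.mul_sum]
      refine Finset.sum_congr rfl fun z _ => ?_
      simp only [Fintype.sum_prod_type (γ := ℝ) (α₁ := ι) (α₂ := κ), Finset.sum_const,
        Finset.card_univ, nsmul_eq_mul, ← hc, ← Finset.mul_sum]
      ring
    rw [h1]
    have h2 : (d : ℝ) / 18 * (17 * c ^ 2 * N / d) = 17 / 18 * (c ^ 2 * N) := by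
      field_simp
    have h3 : 0 < c * N * (N - 1 - d) := by
      have : 0 < N - 1 - d := by linarith
      positivity
    have h4 : 0 < c ^ 2 * N := by positivity
    rw [h2]
    linarith

/-! ### Lattice directions: counting, tightness, net property -/

/-- The nonzero points of `ℤ^d` of squared length at most `4 d`. -/
noncomputable def latticePoints (d : ℕ) : Finset (Fin d → ℤ) :=
  (Fintype.piFinset fun _ => Finset.Icc (-(4 * d : ℤ)) (4 * d)).filter
    fun z => 0 < ∑ k, z k ^ 2 ∧ ∑ k, z k ^ 2 ≤ 4 * d

theorem mem_latticePoints {d : ℕ} {z : Fin d → ℤ} :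
    z ∈ latticePoints d ↔ 0 < ∑ k, z k ^ 2 ∧ ∑ k, z k ^ 2 ≤ 4 * d := by
  simp only [latticePoints, Finset.mem_filter, Fintype.mem_piFinset, Finset.mem_Icc,
    and_iff_right_iff_imp]
  rintro ⟨-, h⟩ k
  have h1 : z k ^ 2 ≤ ∑ k, z k ^ 2 :=
    Finset.single_le_sum (f := fun k => z k ^ 2) (fun _ _ => sq_nonneg _) (Finset.mem_univ k)
  have h2 : |z k| ≤ |z k| ^ 2 := Int.le_self_sq _
  rw [sq_abs] at h2
  exact abs_le.mp (h2.trans (h1.trans h))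

theorem sum_Icc_half_pow_natAbs_le (L : ℕ) :
    ∑ t ∈ Finset.Icc (-(L : ℤ)) L, (1 / 2 : ℝ) ^ t.natAbs ≤ 3 - 2 * (1 / 2) ^ L := by
  induction L with
  | zero => norm_num
  | succ L ih =>
    have h : Finset.Icc (-((L + 1 : ℕ) : ℤ)) ((L + 1 : ℕ) : ℤ) =
        insert (-((L + 1 : ℕ) : ℤ)) (insert ((L + 1 : ℕ) : ℤ) (Finset.Icc (-(L : ℤ)) L)) := by
      ext t
      simp only [Finset.mem_Icc, Finset.mem_insert]
      omega
    rw [h, Finset.sum_insert, Finset.sum_insert, Int.natAbs_neg, Int.natAbs_natCast]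
    · rw [pow_succ]; linarith
    · simp only [Finset.mem_Icc]; omega
    · simp only [Finset.mem_Icc, Finset.mem_insert]; omega

/-- Since `∑ |z k| ≤ ∑ z k ^ 2 ≤ 4 d`, the weight `16 ^ d * ∏ 2 ^ (-|z k|)` is at least `1` on each
point. Its sum over the box factors, each coordinate contributing at most `3`. -/
theorem card_latticePoints_le (d : ℕ) : (latticePoints d).card ≤ 48 ^ d := by
  have h1 : ((latticePoints d).card : ℝ) ≤
      ∑ z ∈ latticePoints d, 16 ^ d * ∏ k, (1 / 2 : ℝ) ^ (z k).natAbs := by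
    rw [Finset.card_eq_sum_ones, Nat.cast_sum]
    refine Finset.sum_le_sum fun z hz => ?_
    have h := (mem_latticePoints.mp hz).2
    have h2 : ∑ k, (z k).natAbs ≤ 4 * d := by
      zify
      refine le_trans (Finset.sum_le_sum fun k _ => ?_) h
      rw [← sq_abs]
      exact Int.le_self_sq _
    rw [Finset.prod_pow_eq_pow_sum, Nat.cast_one]
    have h3 : (1 / 2 : ℝ) ^ (4 * d) ≤ (1 / 2) ^ ∑ k, (z k).natAbs :=
      pow_le_pow_of_le_one (by norm_num) (by norm_num) h2
    calc (1 : ℝ) = 16 ^ d * (1 / 2) ^ (4 * d) := by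
          rw [pow_mul, ← mul_pow]; norm_num
      _ ≤ _ := mul_le_mul_of_nonneg_left h3 (by positivity)
  have h2 : ∑ z ∈ latticePoints d, 16 ^ d * ∏ k, (1 / 2 : ℝ) ^ (z k).natAbs ≤ 16 ^ d * 3 ^ d := by
    rw [← Finset.mul_sum]
    refine mul_le_mul_of_nonneg_left ?_ (by positivity)
    calc ∑ z ∈ latticePoints d, ∏ k, (1 / 2 : ℝ) ^ (z k).natAbs
        ≤ ∑ z ∈ Fintype.piFinset fun _ : Fin d => Finset.Icc (-(4 * d : ℤ)) (4 * d),
            ∏ k, (1 / 2 : ℝ) ^ (z k).natAbs :=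
          Finset.sum_le_sum_of_subset_of_nonneg (Finset.filter_subset _ _)
            fun _ _ _ => by positivity
      _ = ∏ _k : Fin d, ∑ t ∈ Finset.Icc (-(4 * d : ℤ)) (4 * d), (1 / 2 : ℝ) ^ t.natAbs :=
          (Finset.prod_univ_sum (fun _ => Finset.Icc (-(4 * d : ℤ)) (4 * d))
            fun _ t => (1 / 2 : ℝ) ^ t.natAbs).symm
      _ ≤ ∏ _k : Fin d, (3 : ℝ) := by
          refine Finset.prod_le_prod (fun _ _ => by positivity) fun _ _ => ?_
          have := sum_Icc_half_pow_natAbs_le (4 * d)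
          push_cast at this
          have h0 : (0 : ℝ) < (1 / 2) ^ (4 * d) := by positivity
          linarith
      _ = 3 ^ d := by simp
  have h3 : (16 : ℝ) ^ d * 3 ^ d = 48 ^ d := by rw [← mul_pow]; norm_num
  have := h1.trans (h2.trans_eq h3)
  exact_mod_cast this

/-- All sign vectors are among the points, with squared length `d`. -/
theorem two_pow_le_card_latticePoints {d : ℕ} (hd : 0 < d) : 2 ^ d ≤ (latticePoints d).card := by
  have h : Fintype.card (Fin d → ℤˣ) = 2 ^ d := by simp
  rw [← h, ← Finset.card_univ]
  refine Finset.card_le_card_of_injOn (fun s k => (s k : ℤ)) (fun s _ => ?_) ?_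
  · have : ∀ k, ((s k : ℤ)) ^ 2 = 1 := fun k => by
      rcases Int.units_eq_one_or (s k) with h | h <;> simp [h]
    simp only [Finset.mem_coe, mem_latticePoints, this]
    simp
    omega
  · intro s _ t _ hst
    funext k
    exact Units.ext (congrFun hst k)

/-- The unit vector in the direction of a point of `ℤ^d`. -/
noncomputable def direction {d : ℕ} (z : Fin d → ℤ) : EuclideanSpace ℝ (Fin d) :=
  (√(∑ k, (z k : ℝ) ^ 2))⁻¹ • WithLp.toLp 2 fun k => (z k : ℝ)

theorem direction_apply {d : ℕ} (z : Fin d → ℤ) (k : Fin d) :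
    direction z k = (√(∑ k, (z k : ℝ) ^ 2))⁻¹ * z k := rfl

theorem norm_direction {d : ℕ} {z : Fin d → ℤ} (hz : z ∈ latticePoints d) :
    ‖direction z‖ = 1 := by
  have h : (0 : ℝ) < ∑ k, (z k : ℝ) ^ 2 := by exact_mod_cast (mem_latticePoints.mp hz).1
  rw [direction, norm_smul, EuclideanSpace.norm_eq]
  simp only [Real.norm_eq_abs, sq_abs]
  rw [abs_of_pos (by positivity), inv_mul_cancel₀ (by positivity)]

/-- Flipping the sign of coordinate `i` preserves the point set and negates the summand. -/
theorem sum_direction_mul_of_ne {d : ℕ} {i j : Fin d} (hij : i ≠ j) :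
    ∑ z ∈ latticePoints d, direction z i * direction z j = 0 := by
  let φ : (Fin d → ℤ) → Fin d → ℤ := fun z k => if k = i then -z k else z k
  have hsq : ∀ z k, φ z k ^ 2 = z k ^ 2 := by
    intro z k
    simp only [φ]
    split_ifs <;> ring
  have hφφ : ∀ z, φ (φ z) = z := by
    intro z
    funext k
    simp only [φ]
    split_ifs <;> ring
  have hmem : ∀ z ∈ latticePoints d, φ z ∈ latticePoints d := by
    intro z hz
    simpa only [mem_latticePoints, hsq] using hz
  have h : ∑ z ∈ latticePoints d, direction z i * direction z j =
      ∑ z ∈ latticePoints d, -(direction z i * direction z j) := by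
    refine Finset.sum_nbij' φ φ hmem hmem (fun z _ => hφφ z) (fun z _ => hφφ z) fun z _ => ?_
    have h1 : ∀ k, ((φ z k : ℤ) : ℝ) ^ 2 = (z k : ℝ) ^ 2 := fun k => by exact_mod_cast hsq z k
    have hi : φ z i = -z i := by simp [φ]
    have hj : φ z j = z j := by simp [φ, hij.symm]
    simp only [direction_apply, h1, hi, hj]
    push_cast
    ring
  rw [Finset.sum_neg_distrib] at h
  linarith

/-- Swapping coordinates shows that the sum is the same for every `i`; together they add up to the
squared norms, all equal to `1`. -/
theorem sum_direction_sq {d : ℕ} (i : Fin d) :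
    d * ∑ z ∈ latticePoints d, direction z i * direction z i = (latticePoints d).card := by
  have hswap : ∀ j, ∑ z ∈ latticePoints d, direction z j * direction z j =
      ∑ z ∈ latticePoints d, direction z i * direction z i := by
    intro j
    let φ : (Fin d → ℤ) → Fin d → ℤ := fun z k => z (Equiv.swap i j k)
    have hφφ : ∀ z, φ (φ z) = z := by
      intro z
      funext k
      simp [φ]
    have hsum : ∀ z : Fin d → ℤ, ∑ k, φ z k ^ 2 = ∑ k, z k ^ 2 := fun z =>
      Equiv.sum_comp (Equiv.swap i j) fun k => z k ^ 2
    have hmem : ∀ z ∈ latticePoints d, φ z ∈ latticePoints d := by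
      intro z hz
      simpa only [mem_latticePoints, hsum] using hz
    refine Finset.sum_nbij' φ φ hmem hmem (fun z _ => hφφ z) (fun z _ => hφφ z) fun z _ => ?_
    have h1 : ∑ k, ((φ z k : ℤ) : ℝ) ^ 2 = ∑ k, (z k : ℝ) ^ 2 := by exact_mod_cast hsum z
    have hi : φ z i = z j := by simp [φ]
    simp only [direction_apply, h1, hi]
  calc (d : ℝ) * ∑ z ∈ latticePoints d, direction z i * direction z i
      = ∑ j, ∑ z ∈ latticePoints d, direction z j * direction z j := by simp [hswap]
    _ = ∑ z ∈ latticePoints d, ‖direction z‖ ^ 2 := by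
        rw [Finset.sum_comm]
        refine Finset.sum_congr rfl fun z _ => ?_
        rw [EuclideanSpace.real_norm_sq_eq]
        simp only [sq]
    _ = (latticePoints d).card := by
        rw [Finset.sum_congr rfl fun z hz => by rw [norm_direction hz, one_pow]]
        simp

theorem sum_inner_direction_sq {d : ℕ} (w : EuclideanSpace ℝ (Fin d)) :
    d * ∑ z ∈ latticePoints d, inner ℝ w (direction z) ^ 2 =
      (latticePoints d).card * ‖w‖ ^ 2 := by
  have h : ∑ z ∈ latticePoints d, inner ℝ w (direction z) ^ 2 =
      ∑ i, ∑ j, w i * w j * ∑ z ∈ latticePoints d, direction z i * direction z j := by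
    simp only [Finset.mul_sum]
    rw [Finset.sum_congr rfl fun i _ => Finset.sum_comm, Finset.sum_comm]
    refine Finset.sum_congr rfl fun z _ => ?_
    rw [PiLp.inner_apply, sq, Finset.sum_mul_sum]
    refine Finset.sum_congr rfl fun i _ => Finset.sum_congr rfl fun j _ => ?_
    simp only [RCLike.inner_apply, conj_trivial]
    ring
  rw [h, EuclideanSpace.real_norm_sq_eq, Finset.mul_sum, Finset.mul_sum]
  refine Finset.sum_congr rfl fun i _ => ?_
  rw [Finset.sum_eq_single i, ← sum_direction_sq i]
  · ring
  · intro j _ hj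
    rw [sum_direction_mul_of_ne hj.symm, mul_zero]
  · simp

/-- Rounding a real towards zero. -/
theorem exists_int_round (x : ℝ) :
    ∃ t : ℤ, (t : ℝ) ^ 2 ≤ x ^ 2 ∧ x ^ 2 - |x| ≤ x * t := by
  rcases le_total 0 x with h | h
  · refine ⟨⌊x⌋, ?_, ?_⟩
    · have h1 := Int.floor_le x
      have h2 : (0 : ℝ) ≤ ⌊x⌋ := by exact_mod_cast Int.floor_nonneg.mpr h
      nlinarith
    · have := Int.lt_floor_add_one x
      rw [abs_of_nonneg h]
      nlinarith
  · refine ⟨⌈x⌉, ?_, ?_⟩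
    · have h1 := Int.le_ceil x
      have h2 : (⌈x⌉ : ℝ) ≤ 0 := by exact_mod_cast Int.ceil_le.mpr (by simpa using h)
      nlinarith
    · have := Int.ceil_lt_add_one x
      rw [abs_of_nonpos h]
      nlinarith

/-- Scale `w` to a vector `u` of length `2 √d` and round it towards zero to `z`. Then `‖z‖ ≤ 2 √d`,
and `⟪u, z⟫ ≥ ‖u‖² - ‖u‖₁ ≥ 4 d - 2 d` by Cauchy–Schwarz, so the inner product with the direction of
`z` is at least `√d = ‖u‖ / 2`. -/
theorem exists_inner_direction_ge {d : ℕ} (hd : 0 < d) (w : EuclideanSpace ℝ (Fin d)) :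
    ∃ z ∈ latticePoints d, ‖w‖ / 2 ≤ inner ℝ w (direction z) := by
  have hD : (0 : ℝ) < d := by exact_mod_cast hd
  rcases eq_or_ne w 0 with rfl | hw
  · have h := two_pow_le_card_latticePoints hd
    have h2 : 0 < 2 ^ d := by positivity
    obtain ⟨z, hz⟩ := Finset.card_pos.mp (h2.trans_le h)
    exact ⟨z, hz, by simp⟩
  have hwpos : 0 < ‖w‖ := norm_pos_iff.mpr hw
  set r : ℝ := 2 * √d / ‖w‖ with hr
  have hrpos : 0 < r := by positivity
  have hrw : r * ‖w‖ = 2 * √d := by rw [hr]; field_simp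
  choose z hz1 hz2 using fun k => exists_int_round (r * w k)
  have hsq : √(d : ℝ) ^ 2 = d := Real.sq_sqrt hD.le
  have hsum : ∑ k, (r * w k) ^ 2 = 4 * d := by
    simp only [mul_pow, ← Finset.mul_sum]
    rw [← EuclideanSpace.real_norm_sq_eq, ← mul_pow, hrw, mul_pow, hsq]
    norm_num
  have habs : ∑ k, |r * w k| ≤ 2 * d := by
    have h := sq_sum_le_card_mul_sum_sq (s := Finset.univ) (f := fun k => |r * w k|)
    simp only [sq_abs, hsum, Finset.card_univ, Fintype.card_fin] at h
    refine abs_le_of_sq_le_sq' (b := 2 * (d : ℝ)) (le_trans h (le_of_eq (by ring))) (by positivity) |>.2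
  set q : ℝ := ∑ k, (z k : ℝ) ^ 2 with hq
  have hq4 : q ≤ 4 * d := by rw [← hsum]; exact Finset.sum_le_sum fun k _ => hz1 k
  set t : ℝ := ∑ k, w k * z k with ht
  have hrt : 2 * d ≤ r * t := by
    have h1 : ∑ k, ((r * w k) ^ 2 - |r * w k|) ≤ ∑ k, r * w k * z k :=
      Finset.sum_le_sum fun k _ => hz2 k
    rw [Finset.sum_sub_distrib, hsum] at h1
    rw [ht, Finset.mul_sum]
    simp only [mul_assoc] at h1 ⊢
    linarith
  have htpos : 0 < t := by
    by_contra h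
    nlinarith
  have hqpos : 0 < q := by
    have hqnn : 0 ≤ q := Finset.sum_nonneg fun k _ => sq_nonneg _
    refine lt_of_le_of_ne hqnn fun h => htpos.ne' ?_
    refine Finset.sum_eq_zero fun k _ => ?_
    have := (Finset.sum_eq_zero_iff_of_nonneg fun k _ => sq_nonneg (z k : ℝ)).mp h.symm k
      (Finset.mem_univ k)
    rw [pow_eq_zero_iff two_ne_zero |>.mp this, mul_zero]
  have hsq4 : √q ≤ 2 * √d := by
    refine Real.sqrt_le_iff.mpr ⟨by positivity, ?_⟩
    rw [mul_pow, hsq]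
    linarith
  have hin : inner ℝ w (direction z) = (√q)⁻¹ * t := by
    rw [PiLp.inner_apply, ht, Finset.mul_sum]
    refine Finset.sum_congr rfl fun k _ => ?_
    simp only [direction_apply, RCLike.inner_apply, conj_trivial]
    ring
  have hz : z ∈ latticePoints d := by
    rw [hq] at hqpos hq4
    exact mem_latticePoints.mpr ⟨by exact_mod_cast hqpos, by exact_mod_cast hq4⟩
  refine ⟨z, hz, ?_⟩
  rw [hin, inv_mul_eq_div, le_div_iff₀ (Real.sqrt_pos.mpr hqpos)]
  have h3 : ‖w‖ * √d ≤ t := by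
    have : r * (‖w‖ * √d) ≤ r * t := by
      calc r * (‖w‖ * √d) = 2 * √d ^ 2 := by rw [← mul_assoc, hrw]; ring
        _ ≤ r * t := by rw [hsq]; exact hrt
    exact le_of_mul_le_mul_left this hrpos
  nlinarith

/-! ### Choice of parameters and logarithmic growth -/

theorem existsViolation_of_pow_le {d n : ℕ} (hd : 3 ≤ d) (hn : 9216 ^ d ≤ n) :
    ExistsViolation.{u} n (d / 18) := by
  have hd0 : 0 < d := by omega
  have hcard : Fintype.card (latticePoints d) = (latticePoints d).card := Fintype.card_coe _
  have hd2 : d + 1 < 2 ^ d := by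
    clear hn hcard hd0
    induction d, hd using Nat.le_induction with
    | base => norm_num
    | succ k hk ih => rw [pow_succ]; omega
  refine existsViolation_of_frame hd0 (fun z : latticePoints d => direction (z : Fin d → ℤ))
    (fun z => norm_direction z.2) (fun w => ?_) (fun w => ?_) ?_ ?_
  · rw [hcard, ← sum_inner_direction_sq,
      ← Finset.sum_coe_sort (latticePoints d) fun z => inner ℝ w (direction z) ^ 2]
  · obtain ⟨z, hz, h⟩ := exists_inner_direction_ge hd0 w
    exact ⟨⟨z, hz⟩, h⟩
  · rw [hcard]
    exact hd2.trans_le (two_pow_le_card_latticePoints hd0)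
  · rw [hcard]
    refine le_trans ?_ hn
    -- `9216 = 4 * 48 ^ 2`, the factor `4 ^ d` absorbing `2 * d`.
    calc 2 * d * (latticePoints d).card ^ 2 ≤ 4 ^ d * (48 ^ d) ^ 2 := by
          refine Nat.mul_le_mul ?_ (Nat.pow_le_pow_left (card_latticePoints_le d) 2)
          have : 4 ^ d = 2 ^ d * 2 ^ d := by rw [← mul_pow]; norm_num
          rw [this]
          exact Nat.mul_le_mul (by omega) (by omega)
      _ = 9216 ^ d := by rw [← pow_mul, mul_comm d 2, pow_mul, ← mul_pow]; norm_num

/-- With two or more measurements, every factor below one is attained. -/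
theorem existsViolation_of_lt_one {n : ℕ} (hn : 2 ≤ n) {K : ℝ} (hK0 : 0 ≤ K) (hK : K < 1) :
    ExistsViolation.{u} n K := by
  -- Two points with equal vectors: both the classical and the quantum value, doubled, are `2`.
  refine existsViolation_of_kernel (k := 1) (by omega) (Fin.castLEEmb hn) (fun _ _ => 1)
    (fun _ _ => rfl) (fun _ => EuclideanSpace.single 0 1) (fun _ => by simp) (β := 2) hK0
    (fun ε => ?_) ⟨fun _ => 1, by norm_num⟩ ?_
  · rcases Int.units_eq_one_or (ε 0) with h | h <;> rcases Int.units_eq_one_or (ε 1) with h' | h' <;>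
      norm_num [Fin.sum_univ_two, h, h']
  · simp
    linarith

theorem log_nine_thousand_lt : Real.log 9216 < 10 := by
  rw [Real.log_lt_iff_lt_exp (by norm_num)]
  have h := Real.exp_one_gt_d9
  calc (9216 : ℝ) < 2.7 ^ 10 := by norm_num
    _ < Real.exp 1 ^ 10 := by gcongr; linarith
    _ = Real.exp 10 := by rw [← Real.exp_nat_mul]; norm_num

theorem existsViolation_log {n : ℕ} (hn : 2 ≤ n) :
    ExistsViolation.{u} n (1 / 360 * Real.log n) := by
  have hlog := log_nine_thousand_lt
  have hn0 : (0 : ℝ) < n := by positivity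
  set d := Nat.log 9216 n with hd
  have hlt : Real.log n ≤ (d + 1) * 10 := by
    have h1 : n < 9216 ^ (d + 1) := Nat.lt_pow_succ_log_self (by norm_num) n
    have h2 : (n : ℝ) ≤ 9216 ^ (d + 1) := by exact_mod_cast h1.le
    calc Real.log n ≤ Real.log (9216 ^ (d + 1)) := Real.log_le_log hn0 h2
      _ = (d + 1) * Real.log 9216 := by rw [Real.log_pow]; push_cast; rfl
      _ ≤ (d + 1) * 10 := by gcongr
  -- For `d < 3`, `log n ≤ 30` makes the factor less than `1`. For `d ≥ 3`, `10 (d + 1) / 360 ≤ d /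
  -- 18`.
  rcases lt_or_ge d 3 with h | h
  · have h3 : (d : ℝ) + 1 ≤ 3 := by exact_mod_cast h
    refine existsViolation_of_lt_one hn (mul_nonneg (by norm_num) (Real.log_natCast_nonneg n)) ?_
    linarith
  · have h3 : (3 : ℝ) ≤ d := by exact_mod_cast h
    refine (existsViolation_of_pow_le h (Nat.pow_log_le_self 9216 (by omega))).mono ?_
    linarith

end BellViolation

theorem mainTheorem1 :
    (∃ c : ℝ, 0 < c ∧ ∀ n : ℕ, 2 ≤ n → BellViolation.ExistsViolation.{u} n (c * Real.log n)) ∧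
    (∀ K : ℝ, ∃ N : ℕ, ∀ n : ℕ, N ≤ n → BellViolation.ExistsViolation.{u} n K) := by
  refine ⟨⟨1 / 360, by norm_num, fun n hn => BellViolation.existsViolation_log hn⟩, fun K => ?_⟩
  have h : Filter.Tendsto (fun n : ℕ => 1 / 360 * Real.log n) Filter.atTop Filter.atTop :=
    (Real.tendsto_log_atTop.comp tendsto_natCast_atTop_atTop).const_mul_atTop (by norm_num)
  obtain ⟨N, hN⟩ := Filter.eventually_atTop.mp
    ((h.eventually_ge_atTop K).and (Filter.eventually_ge_atTop 2))
  exact ⟨N, fun n hn => (BellViolation.existsViolation_log (hN n hn).2).mono (hN n hn).1⟩
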